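/- A $d$-polytope is the convex hull $P$ of finitely many points in $\mathbb{R}^d$ that has nonempty interior. An inner diagonal of $P$ is a segment $[u,v]$ between two vertices $u \neq v$ of $P$ that meets the interior of $P$. The polytope $P$ is illuminated if every vertex of $P$ lies on an inner diagonal, and simplicial if every facet (face of dimension $d-1$) of $P$ is a simplex. For $d \ge 1$ let $$p(d) = \left\lceil \frac{\sqrt{4d+1}-1}{2} \right\rceil, \qquad M(d) = \min\left\{ 2d,\; d + p(d) + \left\lceil \frac{d}{p(d)} \right\rceil + 1 \right\}.$$ A Mani $d$-polytope is an illuminated $d$-polytope with exactly $M(d)$ vertices. Theorem. For every integer $d \ge 6$ there exists a Mani $d$-polytope that is not simplicial. -/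

import Mathlib

namespace ManiPolytope

/-- `P` is a (full-dimensional, convex) `d`-polytope in `ℝ^d`: the convex hull of finitely many
points, with nonempty interior. -/
def IsPolytope (d : ℕ) (P : Set (EuclideanSpace ℝ (Fin d))) : Prop :=
  (∃ S : Set (EuclideanSpace ℝ (Fin d)), S.Finite ∧ P = convexHull ℝ S) ∧ (interior P).Nonempty

/-- The vertex set of a polytope. -/
def verts {d : ℕ} (P : Set (EuclideanSpace ℝ (Fin d))) : Set (EuclideanSpace ℝ (Fin d)) :=
  P.extremePoints ℝ

/-- The segment `[u, v]` is an inner diagonal of `P`: it connects two (distinct) vertices of `P`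
and passes through the interior of `P`. -/
def IsInnerDiagonal {d : ℕ} (P : Set (EuclideanSpace ℝ (Fin d)))
    (u v : EuclideanSpace ℝ (Fin d)) : Prop :=
  u ∈ verts P ∧ v ∈ verts P ∧ u ≠ v ∧ (segment ℝ u v ∩ interior P).Nonempty

/-- An illuminated `d`-polytope: every vertex lies on an inner diagonal. -/
def IsIlluminated (d : ℕ) (P : Set (EuclideanSpace ℝ (Fin d))) : Prop :=
  IsPolytope d P ∧ ∀ v ∈ verts P, ∃ u, IsInnerDiagonal P u v

/-- `F` is a facet of the `d`-polytope `P`: a nonempty (exposed) face of dimension `d - 1`. -/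
def IsFacet {d : ℕ} (P F : Set (EuclideanSpace ℝ (Fin d))) : Prop :=
  IsExposed ℝ P F ∧ F.Nonempty ∧ Module.finrank ℝ (affineSpan ℝ F).direction + 1 = d

/-- `F` is a simplex: the convex hull of finitely many affinely independent points. -/
def IsSimplex {d : ℕ} (F : Set (EuclideanSpace ℝ (Fin d))) : Prop :=
  ∃ (n : ℕ) (s : Affine.Simplex ℝ (EuclideanSpace ℝ (Fin d)) n),
    F = convexHull ℝ (Set.range s.points)

/-- A polytope is simplicial if all its facets are simplices. -/
def IsSimplicial {d : ℕ} (P : Set (EuclideanSpace ℝ (Fin d))) : Prop :=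
  ∀ F, IsFacet P F → IsSimplex F

/-- `p(d) = ⌈(√(4d+1) - 1) / 2⌉`. -/
noncomputable def p (d : ℕ) : ℕ := ⌈(Real.sqrt (4 * (d : ℝ) + 1) - 1) / 2⌉₊

/-- `M(d) = min {2d, d + p(d) + ⌈d / p(d)⌉ + 1}`. -/
noncomputable def M (d : ℕ) : ℕ := min (2 * d) (d + p d + ⌈(d : ℝ) / (p d : ℝ)⌉₊ + 1)

/-- A Mani `d`-polytope: an illuminated `d`-polytope with exactly `M(d)` vertices. -/
def IsMani (d : ℕ) (P : Set (EuclideanSpace ℝ (Fin d))) : Prop :=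
  IsIlluminated d P ∧ (verts P).ncard = M d

end ManiPolytope

/-!
A polytope in `ℝ^d` with vertices `s i`, `i ∈ I`, is encoded by the `(d + 1)`-dimensional space `E`
of affine functions on `ℝ^d`, on which the vertices act as functionals `ℓ i`. Conversely, functionals
on any space of dimension `d + 1` that are simultaneously positive somewhere come from points of
`ℝ^d` (`exists_points_of_functionals`), so the polytope can be described on the dual side alone:
`s i` is a vertex if some `e` has `ℓ i e = 0` and all other `ℓ k e > 0`; `[s i, s k]` is an inner
diagonal if no nonzero `e` that is nonnegative on all vertices vanishes at both `i` and `k`; and a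
nonnegative `e₀` determined up to scaling by its zero set cuts out a facet, which is not a simplex
if this zero set has more than `d` elements (`exists_nonsimplicial_of_functionals`).

Illumination is obtained by stacking. If every vertex of a polytope is missed by one of a family of
facets, place a new vertex just beyond each facet of the family. A new vertex shares no proper face
with a vertex that its facet misses, so it spans an inner diagonal with every such vertex
(`exists_nonsimplicial_of_stacking`).

The polytope that gets stacked has `d + r` vertices. Partition the `d` coordinates into `r` blocks of
size at least two and at most `q`, and take on `E = ℝ^d × ℝ` the functionals `x v` for the
coordinates and `∑_{v in block i} x v - t` for the blocks. It has `q + 1` suitable facets: one misses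
exactly the block functionals, and the other `q` each miss one coordinate of every block. Stacking
these gives `d + r + q + 1` vertices. The `e₀` with `t = 0` and a single nonzero coordinate vanishes
on all but two of the `d + r` original vertices, so for `r ≥ 3` it gives a facet with more than `d`
vertices (`exists_nonsimplicial_of_partition`).

It remains to choose `r = p(d)` and `q = ⌈d / r⌉`, which requires `p(d) ≥ 3`, that is `d ≥ 7`. For
`d = 6`, where `p(6) = 2`, the choice `r = 3`, `q = 2` gives the same number `M(6) = 12`.
-/

open Set Filter

namespace ManiPolytope

/-! ### Points and affine functions -/

section Realization

variable {d : ℕ} {I : Type*} {s : I → EuclideanSpace ℝ (Fin d)}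

theorem nonneg_of_mem_convexHull_range {a : EuclideanSpace ℝ (Fin d)} {α : ℝ}
    (h : ∀ i, 0 ≤ inner ℝ a (s i) + α) {x : EuclideanSpace ℝ (Fin d)}
    (hx : x ∈ convexHull ℝ (range s)) : 0 ≤ inner ℝ a x + α := by
  have hc : Convex ℝ {x : EuclideanSpace ℝ (Fin d) | -α ≤ innerSL ℝ a x} :=
    convex_halfSpace_ge (innerSL ℝ a).toLinearMap.isLinear _
  have := convexHull_min (s := range s) (by rintro _ ⟨i, rfl⟩; simpa using by linarith [h i]) hc hx
  simp only [mem_ofPred_eq, innerSL_apply_apply] at this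
  linarith

/-- The part of a polytope on which a nonnegative affine function vanishes is an exposed face. -/
theorem isExposed_zeroSet {a : EuclideanSpace ℝ (Fin d)} {α : ℝ}
    (h : ∀ i, 0 ≤ inner ℝ a (s i) + α) :
    IsExposed ℝ (convexHull ℝ (range s)) {x ∈ convexHull ℝ (range s) | inner ℝ a x + α = 0} := by
  rintro ⟨x₀, hx₀, h₀⟩
  refine ⟨-innerSL ℝ a, ?_⟩
  ext x
  simp only [mem_ofPred_eq, neg_apply, innerSL_apply_apply, neg_le_neg_iff]
  refine and_congr_right fun hx ↦ ⟨fun hx0 y hy ↦ ?_, fun H ↦ ?_⟩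
  · linarith [nonneg_of_mem_convexHull_range h hy]
  · linarith [nonneg_of_mem_convexHull_range h hx, H x₀ hx₀]

theorem zeroSet_eq_convexHull [Finite I] {a : EuclideanSpace ℝ (Fin d)} {α : ℝ}
    (h : ∀ i, 0 ≤ inner ℝ a (s i) + α) :
    {x ∈ convexHull ℝ (range s) | inner ℝ a x + α = 0} =
      convexHull ℝ (s '' {i | inner ℝ a (s i) + α = 0}) := by
  have hexp := isExposed_zeroSet h
  have hP : IsCompact (convexHull ℝ (range s)) := (finite_range s).isCompact_convexHull ℝ
  refine subset_antisymm ?_ ?_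
  · conv_lhs => rw [← closure_convexHull_extremePoints (hexp.isCompact hP)
      (hexp.convex (convex_convexHull ℝ _))]
    refine closure_minimal (convexHull_mono ?_) ((toFinite _).isClosed_convexHull ℝ)
    rw [hexp.isExtreme.extremePoints_eq]
    rintro x ⟨⟨-, hx⟩, hx'⟩
    obtain ⟨i, rfl⟩ := extremePoints_convexHull_subset hx'
    exact ⟨i, hx, rfl⟩
  · refine convexHull_min ?_ (hexp.convex (convex_convexHull ℝ _))
    rintro _ ⟨i, hi, rfl⟩
    exact ⟨subset_convexHull ℝ _ ⟨i, rfl⟩, hi⟩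

theorem mem_verts_of_separated [Finite I] {i : I} {a : EuclideanSpace ℝ (Fin d)} {α : ℝ}
    (hi : inner ℝ a (s i) + α = 0) (h : ∀ k, k ≠ i → 0 < inner ℝ a (s k) + α) :
    s i ∈ verts (convexHull ℝ (range s)) := by
  have h' : ∀ k, 0 ≤ inner ℝ a (s k) + α := fun k ↦ by
    by_cases hk : k = i
    · rw [hk, hi]
    · exact (h k hk).le
  have hZ : {k | inner ℝ a (s k) + α = 0} = {i} := by
    ext k
    refine ⟨fun hk ↦ ?_, fun hk ↦ hk ▸ hi⟩
    by_contra hki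
    exact (h k hki).ne' hk
  have hF := zeroSet_eq_convexHull h'
  rw [hZ, image_singleton, convexHull_singleton] at hF
  have hext := (isExposed_zeroSet h').isExtreme
  rw [hF] at hext
  exact hext.extremePoints_subset_extremePoints (by simp)

theorem verts_convexHull_range [Finite I] (h1 : ∀ i, ∃ (a : EuclideanSpace ℝ (Fin d)) (α : ℝ),
      inner ℝ a (s i) + α = 0 ∧ ∀ k, k ≠ i → 0 < inner ℝ a (s k) + α) :
    verts (convexHull ℝ (range s)) = range s := by
  refine subset_antisymm extremePoints_convexHull_subset ?_
  rintro _ ⟨i, rfl⟩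
  obtain ⟨a, α, hi, h⟩ := h1 i
  exact mem_verts_of_separated hi h

theorem injective_of_separated (h1 : ∀ i, ∃ (a : EuclideanSpace ℝ (Fin d)) (α : ℝ),
      inner ℝ a (s i) + α = 0 ∧ ∀ k, k ≠ i → 0 < inner ℝ a (s k) + α) :
    Function.Injective s := by
  intro i k hik
  by_contra hne
  obtain ⟨a, α, hi, h⟩ := h1 i
  exact (h k (Ne.symm hne)).ne' (hik ▸ hi)

theorem mem_orthogonal_vectorSpan_iff {Z : Set I} {z₀ : I} (hz₀ : z₀ ∈ Z)
    {a : EuclideanSpace ℝ (Fin d)} :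
    a ∈ (vectorSpan ℝ (s '' Z))ᗮ ↔ ∀ z ∈ Z, inner ℝ a (s z) - inner ℝ a (s z₀) = 0 := by
  rw [Submodule.mem_orthogonal', vectorSpan_eq_span_vsub_set_right ℝ (mem_image_of_mem s hz₀)]
  constructor
  · intro h z hz
    have := h (s z - s z₀) (Submodule.subset_span ⟨s z, mem_image_of_mem s hz, rfl⟩)
    rwa [inner_sub_right] at this
  · intro h u hu
    induction hu using Submodule.span_induction with
    | mem x hx =>
      obtain ⟨_, ⟨z, hz, rfl⟩, rfl⟩ := hx
      simpa [inner_sub_right] using h z hz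
    | zero => simp
    | add x y _ _ hx hy => rw [inner_add_right, hx, hy, add_zero]
    | smul c x _ hx => rw [inner_smul_right, hx, mul_zero]

/-- If only the zero affine function vanishes on all the points, their hull is a body. -/
theorem interior_nonempty_of_separating [Finite I] [Nonempty I]
    (h : ∀ (a : EuclideanSpace ℝ (Fin d)) (α : ℝ), (∀ i, inner ℝ a (s i) + α = 0) → a = 0) :
    (interior (convexHull ℝ (range s))).Nonempty := by
  rw [interior_convexHull_nonempty_iff_affineSpan_eq_top,
    AffineSubspace.affineSpan_eq_top_iff_vectorSpan_eq_top_of_nonempty _ _ _ (range_nonempty s),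
    ← Submodule.orthogonal_eq_bot_iff, Submodule.eq_bot_iff]
  intro a ha
  let i₀ := Classical.arbitrary I
  rw [← image_univ, mem_orthogonal_vectorSpan_iff (mem_univ i₀)] at ha
  exact h a (-inner ℝ a (s i₀)) fun i ↦ by linarith [ha i (mem_univ i)]

/-- Two vertices span an inner diagonal as soon as no supporting hyperplane contains both. -/
theorem segment_inter_interior_nonempty {i k : I}
    (hint : (interior (convexHull ℝ (range s))).Nonempty)
    (h : ∀ (a : EuclideanSpace ℝ (Fin d)) (α : ℝ), (∀ m, 0 ≤ inner ℝ a (s m) + α) →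
      inner ℝ a (s i) + α = 0 → inner ℝ a (s k) + α = 0 → a = 0) :
    (segment ℝ (s i) (s k) ∩ interior (convexHull ℝ (range s))).Nonempty := by
  set P := convexHull ℝ (range s) with hP
  refine ⟨midpoint ℝ (s i) (s k), midpoint_mem_segment _ _, ?_⟩
  by_contra hm
  have hconv : Convex ℝ P := convex_convexHull ℝ _
  obtain ⟨f, hf⟩ := geometric_hahn_banach_open_point hconv.interior isOpen_interior hm
  have hle : ∀ x ∈ P, f x ≤ f (midpoint ℝ (s i) (s k)) := by
    intro x hx
    have hx' : x ∈ closure (interior P) := by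
      rw [hconv.closure_interior_eq_closure_of_nonempty_interior hint]
      exact subset_closure hx
    exact closure_minimal (fun y hy ↦ (hf y hy).le)
      (isClosed_le f.continuous continuous_const) hx'
  have hmid : f (midpoint ℝ (s i) (s k)) = (f (s i) + f (s k)) / 2 := by
    rw [midpoint_eq_smul_add, map_smul, map_add, smul_eq_mul, invOf_eq_inv]; ring
  have hmem : ∀ m, s m ∈ P := fun m ↦ subset_convexHull ℝ _ ⟨m, rfl⟩
  obtain ⟨a, ha⟩ : ∃ a : EuclideanSpace ℝ (Fin d), ∀ x, inner ℝ a x = f x :=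
    ⟨(InnerProductSpace.toDual ℝ _).symm f, fun x ↦ InnerProductSpace.toDual_symm_apply⟩
  have h0 := h (-a) (f (midpoint ℝ (s i) (s k)))
    (fun m ↦ by rw [inner_neg_left, ha]; linarith [hle _ (hmem m)])
    (by rw [inner_neg_left, ha]; linarith [hle _ (hmem i), hle _ (hmem k)])
    (by rw [inner_neg_left, ha]; linarith [hle _ (hmem i), hle _ (hmem k)])
  obtain ⟨y, hy⟩ := hint
  have := hf y hy
  rw [← ha, ← ha, neg_eq_zero.1 h0] at this
  simp at this

theorem isFacet_zeroSet [Finite I] {a : EuclideanSpace ℝ (Fin d)} {α : ℝ} (ha : a ≠ 0)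
    (h : ∀ i, 0 ≤ inner ℝ a (s i) + α) {z₀ : I} (hz₀ : inner ℝ a (s z₀) + α = 0)
    (huniq : ∀ (b : EuclideanSpace ℝ (Fin d)) (β : ℝ),
      (∀ i, inner ℝ a (s i) + α = 0 → inner ℝ b (s i) + β = 0) → ∃ t : ℝ, b = t • a) :
    IsFacet (convexHull ℝ (range s)) {x ∈ convexHull ℝ (range s) | inner ℝ a x + α = 0} := by
  refine ⟨isExposed_zeroSet h, ⟨s z₀, subset_convexHull ℝ _ ⟨z₀, rfl⟩, hz₀⟩, ?_⟩
  have hz : z₀ ∈ {i | inner ℝ a (s i) + α = 0} := hz₀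
  rw [zeroSet_eq_convexHull h, affineSpan_convexHull, direction_affineSpan]
  have hspan : (vectorSpan ℝ (s '' {i | inner ℝ a (s i) + α = 0}))ᗮ = ℝ ∙ a := by
    ext b
    rw [mem_orthogonal_vectorSpan_iff hz, Submodule.mem_span_singleton]
    constructor
    · intro hb
      obtain ⟨t, ht⟩ := huniq b (-inner ℝ b (s z₀)) fun i hi ↦ by linarith [hb i hi]
      exact ⟨t, ht.symm⟩
    · rintro ⟨t, rfl⟩ z hz'
      have hz' : inner ℝ a (s z) + α = 0 := hz'
      rw [real_inner_smul_left, real_inner_smul_left, ← mul_sub,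
        show inner ℝ a (s z) - inner ℝ a (s z₀) = 0 by linarith, mul_zero]
  have := (vectorSpan ℝ (s '' {i | inner ℝ a (s i) + α = 0})).finrank_add_finrank_orthogonal
  rwa [hspan, finrank_span_singleton ha, finrank_euclideanSpace_fin] at this

/-- A `(d - 1)`-simplex has only `d` vertices, so a facet with more vertices is not a simplex. -/
theorem not_isSimplex_of_lt_ncard {P F : Set (EuclideanSpace ℝ (Fin d))} (hF : IsFacet P F)
    (hcard : d < (F.extremePoints ℝ).ncard) : ¬ IsSimplex F := by
  rintro ⟨n, σ, hσ⟩
  have hdim := hF.2.2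
  rw [hσ, affineSpan_convexHull, direction_affineSpan,
    σ.independent.finrank_vectorSpan (Fintype.card_fin _)] at hdim
  have hsub : F.extremePoints ℝ ⊆ range σ.points := by
    rw [hσ]; exact extremePoints_convexHull_subset
  have h1 := ncard_le_ncard hsub (finite_range _)
  have h2 : (range σ.points).ncard ≤ n + 1 := by
    rw [← image_univ]
    exact (ncard_image_le finite_univ).trans (by simp)
  omega

theorem exists_nonsimplicial_of_points [Finite I]
    (h1 : ∀ i, ∃ (a : EuclideanSpace ℝ (Fin d)) (α : ℝ),
      inner ℝ a (s i) + α = 0 ∧ ∀ k, k ≠ i → 0 < inner ℝ a (s k) + α)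
    (h2 : ∀ i, ∃ k, k ≠ i ∧ ∀ (a : EuclideanSpace ℝ (Fin d)) (α : ℝ),
      (∀ m, 0 ≤ inner ℝ a (s m) + α) →
      inner ℝ a (s i) + α = 0 → inner ℝ a (s k) + α = 0 → a = 0)
    {a : EuclideanSpace ℝ (Fin d)} {α : ℝ} (ha : a ≠ 0) (h : ∀ i, 0 ≤ inner ℝ a (s i) + α)
    (hcard : d < {i | inner ℝ a (s i) + α = 0}.ncard)
    (huniq : ∀ (b : EuclideanSpace ℝ (Fin d)) (β : ℝ),
      (∀ i, inner ℝ a (s i) + α = 0 → inner ℝ b (s i) + β = 0) → ∃ t : ℝ, b = t • a) :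
    ∃ P : Set (EuclideanSpace ℝ (Fin d)),
      IsIlluminated d P ∧ (verts P).ncard = Nat.card I ∧ ¬ IsSimplicial P := by
  have hinj := injective_of_separated h1
  have hverts := verts_convexHull_range h1
  obtain ⟨z₀, hz₀⟩ := nonempty_of_ncard_ne_zero (Nat.ne_zero_of_lt hcard)
  have : Nonempty I := ⟨z₀⟩
  have hint : (interior (convexHull ℝ (range s))).Nonempty := by
    obtain ⟨k, -, hk⟩ := h2 z₀
    exact interior_nonempty_of_separating fun a α h0 ↦
      hk a α (fun m ↦ (h0 m).ge) (h0 z₀) (h0 k)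
  refine ⟨convexHull ℝ (range s), ⟨⟨⟨_, finite_range s, rfl⟩, hint⟩, ?_⟩, ?_, fun hsimp ↦ ?_⟩
  · rw [hverts]
    rintro _ ⟨i, rfl⟩
    obtain ⟨k, hki, hk⟩ := h2 i
    exact ⟨s k, hverts.ge ⟨k, rfl⟩, hverts.ge ⟨i, rfl⟩, hinj.ne hki,
      segment_inter_interior_nonempty hint fun a α h hk' hi ↦ hk a α h hi hk'⟩
  · rw [hverts, ← image_univ, ncard_image_of_injective _ hinj, ncard_univ]
  · have hF := isFacet_zeroSet ha h hz₀ huniq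
    refine not_isSimplex_of_lt_ncard hF ?_ (hsimp _ hF)
    have hext : s '' {i | inner ℝ a (s i) + α = 0} ⊆
        ({x ∈ convexHull ℝ (range s) | inner ℝ a x + α = 0}).extremePoints ℝ := by
      rw [hF.1.isExtreme.extremePoints_eq]
      rintro _ ⟨i, hi, rfl⟩
      exact ⟨⟨subset_convexHull ℝ _ ⟨i, rfl⟩, hi⟩, hverts.ge ⟨i, rfl⟩⟩
    rw [← ncard_image_of_injective _ hinj] at hcard
    refine hcard.trans_le (ncard_le_ncard hext ?_)
    rw [zeroSet_eq_convexHull h]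
    exact (toFinite _).subset extremePoints_convexHull_subset

end Realization

/-! ### Duality between points and functionals -/

section Duality

variable {d : ℕ} {E : Type*} [AddCommGroup E] [Module ℝ E]

/-- Homogenization: a vector space of dimension `d + 1` with a distinguished nonzero vector `c`
is the space of affine functions on `ℝ^d`, with `c` the constant function `1`. -/
theorem exists_linearEquiv_affine (hE : Module.finrank ℝ E = d + 1) {c : E} (hc : c ≠ 0) :
    ∃ Φ : (EuclideanSpace ℝ (Fin d) × ℝ) ≃ₗ[ℝ] E, Φ (0, 1) = c := by
  have : FiniteDimensional ℝ E := Module.finite_of_finrank_eq_succ hE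
  obtain ⟨K, hK⟩ := Submodule.exists_isCompl (ℝ ∙ c)
  have hKd : Module.finrank ℝ K = d := by
    have := Submodule.finrank_add_eq_of_isCompl hK
    rw [finrank_span_singleton hc] at this
    omega
  let e : EuclideanSpace ℝ (Fin d) ≃ₗ[ℝ] K :=
    LinearEquiv.ofFinrankEq _ _ (by rw [finrank_euclideanSpace_fin, hKd])
  refine ⟨(e.prodCongr (LinearEquiv.toSpanNonzeroSingleton ℝ E c hc)).trans
    (Submodule.prodEquivOfIsCompl K (ℝ ∙ c) hK.symm), ?_⟩
  simp

/-- Gale-type duality: functionals `ℓ i` on a space of dimension `d + 1` that are simultaneously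
positive somewhere are, up to positive factors, the evaluations of affine functions at points of
`ℝ^d`. -/
theorem exists_points_of_functionals {I : Type*} (hE : Module.finrank ℝ E = d + 1)
    (ℓ : I → E →ₗ[ℝ] ℝ) {c : E} (hc0 : c ≠ 0) (hc : ∀ i, 0 < ℓ i c) :
    ∃ (Φ : (EuclideanSpace ℝ (Fin d) × ℝ) ≃ₗ[ℝ] E) (s : I → EuclideanSpace ℝ (Fin d)),
      ∀ i a α, ℓ i (Φ (a, α)) = ℓ i c * (inner ℝ a (s i) + α) := by
  obtain ⟨Φ, hΦ⟩ := exists_linearEquiv_affine hE hc0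
  have hrep : ∀ i, ∃ v : EuclideanSpace ℝ (Fin d), ∀ a, inner ℝ a v = ℓ i (Φ (a, 0)) := by
    intro i
    let f : EuclideanSpace ℝ (Fin d) →ₗ[ℝ] ℝ :=
      ℓ i ∘ₗ Φ.toLinearMap ∘ₗ LinearMap.inl ℝ _ _
    refine ⟨(InnerProductSpace.toDual ℝ _).symm (LinearMap.toContinuousLinearMap f), fun a ↦ ?_⟩
    rw [real_inner_comm, InnerProductSpace.toDual_symm_apply]
    rfl
  choose v hv using hrep
  refine ⟨Φ, fun i ↦ (ℓ i c)⁻¹ • v i, fun i a α ↦ ?_⟩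
  have hsplit : ((a, α) : EuclideanSpace ℝ (Fin d) × ℝ) = (a, 0) + α • (0, 1) := by simp
  rw [hsplit, map_add, map_add, map_smul, map_smul, hΦ, ← hv, real_inner_smul_right, mul_add,
    mul_inv_cancel_left₀ (hc i).ne', smul_eq_mul, mul_comm α]

theorem exists_nonsimplicial_of_functionals {I : Type*} [Finite I]
    (hE : Module.finrank ℝ E = d + 1) (ℓ : I → E →ₗ[ℝ] ℝ)
    {c : E} (hc : ∀ i, 0 < ℓ i c)
    (h1 : ∀ i, ∃ e, ℓ i e = 0 ∧ ∀ k, k ≠ i → 0 < ℓ k e)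
    (h2 : ∀ i, ∃ k, k ≠ i ∧ ∀ e, (∀ m, 0 ≤ ℓ m e) → ℓ i e = 0 → ℓ k e = 0 → e = 0)
    {e₀ : E} (he₀ : e₀ ≠ 0) (hnn : ∀ i, 0 ≤ ℓ i e₀) (hcard : d < {i | ℓ i e₀ = 0}.ncard)
    (huniq : ∀ e, (∀ i, ℓ i e₀ = 0 → ℓ i e = 0) → ∃ t : ℝ, e = t • e₀) :
    ∃ P : Set (EuclideanSpace ℝ (Fin d)),
      IsIlluminated d P ∧ (verts P).ncard = Nat.card I ∧ ¬ IsSimplicial P := by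
  obtain ⟨z₀, hz₀⟩ := nonempty_of_ncard_ne_zero (Nat.ne_zero_of_lt hcard)
  have hc0 : c ≠ 0 := by
    rintro rfl
    simpa using hc z₀
  obtain ⟨Φ, s, hs⟩ := exists_points_of_functionals hE ℓ hc0 hc
  have hzero : ∀ i a α, inner ℝ a (s i) + α = 0 ↔ ℓ i (Φ (a, α)) = 0 := fun i a α ↦ by
    rw [hs, mul_eq_zero, or_iff_right (hc i).ne']
  have hpos : ∀ i a α, 0 < inner ℝ a (s i) + α ↔ 0 < ℓ i (Φ (a, α)) := fun i a α ↦ by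
    rw [hs, mul_pos_iff_of_pos_left (hc i)]
  have hnonneg : ∀ i a α, 0 ≤ inner ℝ a (s i) + α ↔ 0 ≤ ℓ i (Φ (a, α)) := fun i a α ↦ by
    rw [hs, mul_nonneg_iff_of_pos_left (hc i)]
  obtain ⟨⟨a₀, α₀⟩, rfl⟩ := Φ.surjective e₀
  refine exists_nonsimplicial_of_points (s := s) (a := a₀) (α := α₀) (fun i ↦ ?_) (fun i ↦ ?_)
    ?_ (fun i ↦ (hnonneg ..).2 (hnn i)) ?_ ?_
  · obtain ⟨e, hi, hk⟩ := h1 i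
    obtain ⟨⟨a, α⟩, rfl⟩ := Φ.surjective e
    exact ⟨a, α, (hzero ..).2 hi, fun k hki ↦ (hpos ..).2 (hk k hki)⟩
  · obtain ⟨k, hki, hk⟩ := h2 i
    refine ⟨k, hki, fun a α hm hi hk' ↦ ?_⟩
    have := hk (Φ (a, α)) (fun m ↦ (hnonneg ..).1 (hm m)) ((hzero ..).1 hi) ((hzero ..).1 hk')
    exact (Prod.ext_iff.1 ((LinearEquiv.map_eq_zero_iff Φ).1 this)).1
  · -- a nonzero constant function does not vanish at `s z₀`
    rintro rfl
    have hα : α₀ = 0 := by simpa using (hzero z₀ 0 α₀).2 hz₀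
    exact he₀ (by rw [hα]; exact map_zero Φ)
  · simpa only [hzero] using hcard
  · intro b β hb
    obtain ⟨t, ht⟩ := huniq (Φ (b, β)) fun i hi ↦ (hzero ..).1 (hb i ((hzero ..).2 hi))
    rw [← map_smul] at ht
    exact ⟨t, (Prod.ext_iff.1 (Φ.injective ht)).1⟩

end Duality

/-! ### Stacking -/

section Stacking

variable {d : ℕ} {E : Type*} [AddCommGroup E] [Module ℝ E]
variable {V J : Type*} [Fintype V] [DecidableEq V]

/-- The functional of a new vertex, in terms of the functionals `x v` of the vertices of a polytope,
the vertices outside `T j` being those of a facet. For large `K` the new vertex lies, up to scaling,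
just beyond a relative interior point of that facet. -/
def stacked (x : V → E →ₗ[ℝ] ℝ) (T : J → Finset V) (K : ℝ) (j : J) : E →ₗ[ℝ] ℝ :=
  K • ∑ v ∈ (T j)ᶜ, x v - ∑ v ∈ T j, x v

theorem stacked_apply (x : V → E →ₗ[ℝ] ℝ) (T : J → Finset V) (K : ℝ) (j : J) (e : E) :
    stacked x T K j e = K * ∑ v ∈ (T j)ᶜ, x v e - ∑ v ∈ T j, x v e := by
  simp [stacked, LinearMap.sum_apply]

theorem eventually_stacked_pos {x : V → E →ₗ[ℝ] ℝ} {T : J → Finset V} {j : J} {e : E}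
    (hnn : ∀ v, 0 ≤ x v e) {v : V} (hv : v ∉ T j) (hpos : 0 < x v e) :
    ∀ᶠ K in atTop, 0 < stacked x T K j e := by
  have hA : 0 < ∑ v ∈ (T j)ᶜ, x v e :=
    Finset.sum_pos' (fun u _ ↦ hnn u) ⟨v, Finset.mem_compl.2 hv, hpos⟩
  filter_upwards [(tendsto_id.atTop_mul_const hA).eventually_gt_atTop (∑ v ∈ T j, x v e)] with K hK
  rw [stacked_apply]
  exact sub_pos.2 hK

/-- Stacking on facets whose complements cover the vertex set produces an illuminated polytope:
each new vertex is joined by an inner diagonal to every vertex its facet misses. -/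
theorem exists_nonsimplicial_of_stacking [Finite J]
    (hE : Module.finrank ℝ E = d + 1) (x : V → E →ₗ[ℝ] ℝ) (T : J → Finset V) (C : ℝ)
    (hsep : ∀ e, (∀ v, x v e = 0) → e = 0)
    (hvert : ∀ v, ∃ e, x v e = 0 ∧ ∀ u, u ≠ v → 0 < x u e)
    (hind : ∀ j, ∃ e, ∀ v, x v e = if v ∈ T j then 1 else 0)
    (hC : ∀ j, ∀ v ∈ T j, ∀ e, (∀ u, 0 ≤ x u e) → x v e = 0 →
      ∑ u ∈ T j, x u e ≤ C * ∑ u ∈ (T j)ᶜ, x u e)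
    (hne : ∀ j, (T j).Nonempty) (hcov : ∀ v, ∃ j, v ∈ T j)
    (hT : ∀ j k, j ≠ k → ∃ v ∈ T j, v ∉ T k) (hTc : ∀ j v, ∃ u, u ∉ T j ∧ u ≠ v)
    {e₀ : E} (he₀ : e₀ ≠ 0) (hnn : ∀ v, 0 ≤ x v e₀) (hsupp : ∀ j, ∃ v, v ∉ T j ∧ 0 < x v e₀)
    (hcard : d < {v | x v e₀ = 0}.ncard)
    (huniq : ∀ e, (∀ v, x v e₀ = 0 → x v e = 0) → ∃ t : ℝ, e = t • e₀) :
    ∃ P : Set (EuclideanSpace ℝ (Fin d)), IsIlluminated d P ∧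
      (verts P).ncard = Nat.card V + Nat.card J ∧ ¬ IsSimplicial P := by
  choose f hf0 hfpos using hvert
  choose g hg using hind
  have hfnn : ∀ v u, 0 ≤ x u (f v) := fun v u ↦ by
    by_cases h : u = v
    · rw [h, hf0]
    · exact (hfpos v u h).le
  have hK₁ : ∀ᶠ K in atTop, ∀ v j, 0 < stacked x T K j (f v) := by
    refine eventually_all.2 fun v ↦ eventually_all.2 fun j ↦ ?_
    obtain ⟨u, hu, huv⟩ := hTc j v
    exact eventually_stacked_pos (hfnn v) hu (hfpos v u huv)
  have hK₂ : ∀ᶠ K in atTop, ∀ j, 0 < stacked x T K j e₀ := by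
    refine eventually_all.2 fun j ↦ ?_
    obtain ⟨u, hu, hu'⟩ := hsupp j
    exact eventually_stacked_pos hnn hu hu'
  have hgnn : ∀ j v, 0 ≤ x v (g j) := fun j v ↦ by
    rw [hg]; split_ifs <;> norm_num
  have hK₃ : ∀ᶠ K in atTop, ∀ j k, j ≠ k → 0 < stacked x T K k (g j) := by
    refine eventually_all.2 fun j ↦ eventually_all.2 fun k ↦ ?_
    by_cases hjk : j = k
    · exact Eventually.of_forall fun K h ↦ absurd hjk h
    obtain ⟨u, hu, hu'⟩ := hT j k hjk
    filter_upwards [eventually_stacked_pos (hgnn j) hu' (by rw [hg, if_pos hu]; exact one_pos)]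
      with K hK _ using hK
  obtain ⟨K, hf, he, hgK, hKC⟩ := (hK₁.and (hK₂.and (hK₃.and (eventually_gt_atTop C)))).exists
  obtain ⟨v₀, -⟩ := nonempty_of_ncard_ne_zero (Nat.ne_zero_of_lt hcard)
  -- a vector on which all functionals are positive
  set c : E := ∑ v, f v with hc
  have hcx : ∀ u, 0 < x u c := fun u ↦ by
    obtain ⟨j, -⟩ := hcov u
    obtain ⟨v, -, hvu⟩ := hTc j u
    rw [hc, map_sum]
    exact Finset.sum_pos' (fun v _ ↦ hfnn v u) ⟨v, Finset.mem_univ v, hfpos v u hvu.symm⟩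
  have hcw : ∀ j, 0 < stacked x T K j c := fun j ↦ by
    rw [hc, map_sum]
    exact Finset.sum_pos (fun v _ ↦ hf v j) ⟨v₀, Finset.mem_univ v₀⟩
  have hdiag : ∀ j, ∀ v ∈ T j, ∀ e, (∀ u, 0 ≤ x u e) → x v e = 0 →
      stacked x T K j e = 0 → e = 0 := by
    intro j v hv e hu hv0 hw
    rw [stacked_apply] at hw
    have hle := hC j v hv e hu hv0
    have hA0 : 0 ≤ ∑ u ∈ (T j)ᶜ, x u e := Finset.sum_nonneg fun u _ ↦ hu u
    have hB0 : 0 ≤ ∑ u ∈ T j, x u e := Finset.sum_nonneg fun u _ ↦ hu u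
    have hA : ∑ u ∈ (T j)ᶜ, x u e = 0 := by
      by_contra hA
      nlinarith [lt_of_le_of_ne hA0 (Ne.symm hA)]
    have hB : ∑ u ∈ T j, x u e = 0 := by
      rw [hA] at hw; linarith
    refine hsep e fun u ↦ ?_
    by_cases huT : u ∈ T j
    · exact (Finset.sum_eq_zero_iff_of_nonneg fun u _ ↦ hu u).1 hB u huT
    · exact (Finset.sum_eq_zero_iff_of_nonneg fun u _ ↦ hu u).1 hA u (Finset.mem_compl.2 huT)
  have key := exists_nonsimplicial_of_functionals (I := V ⊕ J) hE
    (Sum.elim x (stacked x T K)) (c := c) (e₀ := e₀) ?_ ?_ ?_ he₀ ?_ ?_ ?_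
  · simpa [Nat.card_sum] using key
  · rintro (v | j)
    exacts [hcx v, hcw j]
  · rintro (v | j)
    · refine ⟨f v, hf0 v, ?_⟩
      rintro (u | j) h
      exacts [hfpos v u fun h' ↦ h (h' ▸ rfl), hf v j]
    · -- push the indicator of `T j`, where the new functional is negative, towards `c`
      have hneg : stacked x T K j (g j) = -(T j).card := by
        rw [stacked_apply, Finset.sum_congr rfl fun v hv ↦ (hg j v).trans
          (if_neg (Finset.mem_compl.1 hv)), Finset.sum_congr rfl fun v hv ↦ (hg j v).trans
          (if_pos hv)]
        simp
      have hTpos : (0 : ℝ) < (T j).card := by exact_mod_cast (hne j).card_pos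
      refine ⟨stacked x T K j c • g j + ((T j).card : ℝ) • c, ?_, ?_⟩
      · simp only [Sum.elim_inr, map_add, map_smul, smul_eq_mul, hneg]
        ring
      · rintro (u | k) h
        · simp only [Sum.elim_inl, map_add, map_smul, smul_eq_mul]
          exact add_pos_of_nonneg_of_pos (mul_nonneg (hcw j).le (hgnn j u)) (mul_pos hTpos (hcx u))
        · simp only [Sum.elim_inr, map_add, map_smul, smul_eq_mul]
          exact add_pos (mul_pos (hcw j) (hgK j k fun h' ↦ h (h' ▸ rfl))) (mul_pos hTpos (hcw k))
  · rintro (v | j)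
    · obtain ⟨j, hj⟩ := hcov v
      exact ⟨Sum.inr j, Sum.inr_ne_inl, fun e hm hv hw ↦
        hdiag j v hj e (fun u ↦ hm (Sum.inl u)) hv hw⟩
    · obtain ⟨v, hv⟩ := hne j
      exact ⟨Sum.inl v, Sum.inl_ne_inr, fun e hm hw hv0 ↦
        hdiag j v hv e (fun u ↦ hm (Sum.inl u)) hv0 hw⟩
  · rintro (v | j)
    exacts [hnn v, (he j).le]
  · refine hcard.trans_le ?_
    rw [← ncard_image_of_injective _ (Sum.inl_injective (β := J))]
    refine ncard_le_ncard ?_ (toFinite _)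
    rintro _ ⟨v, hv, rfl⟩
    exact hv
  · exact fun e h ↦ huniq e fun v hv ↦ h (Sum.inl v) hv

end Stacking

/-! ### Partitions of the coordinates -/

section Blocks

variable {D R J : Type*}

/-- The facet functionals, in homogeneous coordinates `(x, t)`, for a partition `β` of the
coordinate set `D` into blocks indexed by `R`: the coordinates `x v`, and for each block the
difference between its coordinate sum and `t`. -/
def blockFunctional [Fintype D] [DecidableEq R] (β : D → R) : D ⊕ R → ((D → ℝ) × ℝ) →ₗ[ℝ] ℝ :=
  Sum.elim (fun v ↦ LinearMap.proj v ∘ₗ LinearMap.fst ℝ _ _)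
    (fun i ↦ ∑ v with β v = i, LinearMap.proj v ∘ₗ LinearMap.fst ℝ _ _ - LinearMap.snd ℝ _ _)

@[simp]
theorem blockFunctional_inl [Fintype D] [DecidableEq R] (β : D → R) (v : D) (e : (D → ℝ) × ℝ) :
    blockFunctional β (Sum.inl v) e = e.1 v := rfl

@[simp]
theorem blockFunctional_inr [Fintype D] [DecidableEq R] (β : D → R) (i : R) (e : (D → ℝ) × ℝ) :
    blockFunctional β (Sum.inr i) e = ∑ v with β v = i, e.1 v - e.2 := by
  simp [blockFunctional, LinearMap.sum_apply]

/-- The complements of the facets that get stacked: the set of all block functionals, and for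
each `j` the set of coordinates picked by the section `σ j` of the partition. -/
def transversal [DecidableEq D] [Fintype R] [DecidableEq R] (σ : J → R → D) :
    Option J → Finset (D ⊕ R)
  | none => Finset.univ.image Sum.inr
  | some j => Finset.univ.image fun i ↦ Sum.inl (σ j i)

theorem card_transversal_le [DecidableEq D] [Fintype R] [DecidableEq R] (σ : J → R → D) (j : Option J) :
    (transversal σ j).card ≤ Fintype.card R := by
  cases j <;> exact Finset.card_image_le

theorem mem_transversal_none [DecidableEq D] [Fintype R] [DecidableEq R]
    {σ : J → R → D} {v : D ⊕ R} :
    v ∈ transversal σ none ↔ ∃ i, Sum.inr i = v := by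
  simp [transversal]

theorem mem_transversal_some [DecidableEq D] [Fintype R] [DecidableEq R]
    {σ : J → R → D} {j : J} {v : D ⊕ R} :
    v ∈ transversal σ (some j) ↔ ∃ i, Sum.inl (σ j i) = v := by
  simp [transversal]

theorem exists_blockFunctional_eq_indicator [Fintype D] [DecidableEq D] [Fintype R] [DecidableEq R]
    {β : D → R} {σ : J → R → D}
    (hσ : ∀ j i, β (σ j i) = i) (j : Option J) :
    ∃ e, ∀ v, blockFunctional β v e = if v ∈ transversal σ j then 1 else 0 := by
  cases j with
  | none =>
    refine ⟨(0, -1), ?_⟩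
    rintro (v | i) <;> simp [mem_transversal_none]
  | some j =>
    refine ⟨(fun v ↦ if v = σ j (β v) then 1 else 0, 1), ?_⟩
    rintro (v | i)
    · have : (∃ i, σ j i = v) ↔ v = σ j (β v) :=
        ⟨fun ⟨i, h⟩ ↦ by rw [← h, hσ], fun h ↦ ⟨_, h.symm⟩⟩
      simp [mem_transversal_some, this]
    · have hsum : ∑ v with β v = i, (if v = σ j (β v) then (1 : ℝ) else 0) = 1 := by
        rw [Finset.sum_congr rfl (g := fun v ↦ if v = σ j i then (1 : ℝ) else 0)
          fun v hv ↦ by rw [(Finset.mem_filter.1 hv).2]]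
        simp [hσ]
      simp [mem_transversal_some, hsum]

theorem exists_blockFunctional_vertex [Fintype D] [DecidableEq D] [Fintype R] [DecidableEq R]
    {β : D → R} (hβ : ∀ v, ∃ u, u ≠ v ∧ β u = β v)
    (hsurj : Function.Surjective β) (v : D ⊕ R) :
    ∃ e, blockFunctional β v e = 0 ∧ ∀ u, u ≠ v → 0 < blockFunctional β u e := by
  rcases v with v | i
  · refine ⟨(fun u ↦ if u = v then 0 else 1, 0), by simp, ?_⟩
    have hnn : ∀ u, (0 : ℝ) ≤ if u = v then 0 else 1 := fun u ↦ by split_ifs <;> norm_num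
    rintro (u | k) h
    · have : u ≠ v := fun h' ↦ h (h' ▸ rfl)
      simp [this]
    · rw [blockFunctional_inr, sub_zero]
      obtain ⟨w, rfl⟩ := hsurj k
      obtain ⟨u, huv, huk⟩ : ∃ u, u ≠ v ∧ β u = β w := by
        by_cases hw : w = v
        · exact hw ▸ hβ v
        · exact ⟨w, hw, rfl⟩
      exact Finset.sum_pos' (fun u _ ↦ hnn u) ⟨u, by simpa using huk, by simp [huv]⟩
  · -- block `i` sums to `t = 1`, every other block to more than `1`
    obtain ⟨w, hw⟩ := hsurj i
    have hcard : 0 < (Finset.univ.filter fun v ↦ β v = i).card :=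
      Finset.card_pos.2 ⟨w, by simpa using hw⟩
    have hcard' : (0 : ℝ) < (Finset.univ.filter fun v ↦ β v = i).card := by exact_mod_cast hcard
    set m : ℝ := ((Finset.univ.filter fun v ↦ β v = i).card : ℝ) with hm
    refine ⟨(fun u ↦ if β u = i then m⁻¹ else 2, 1), ?_, ?_⟩
    · rw [blockFunctional_inr, Finset.sum_congr rfl fun v hv ↦ if_pos (Finset.mem_filter.1 hv).2]
      rw [Finset.sum_const, nsmul_eq_mul, ← hm, mul_inv_cancel₀ hcard'.ne', sub_self]
    · rintro (u | k) h
      · rw [blockFunctional_inl]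
        dsimp only
        split_ifs
        · exact inv_pos.2 hcard'
        · norm_num
      · have hki : k ≠ i := fun h' ↦ h (h' ▸ rfl)
        obtain ⟨w, hw⟩ := hsurj k
        have h1 : (1 : ℝ) ≤ (Finset.univ.filter fun v ↦ β v = k).card := by
          exact_mod_cast Finset.card_pos.2 ⟨w, by simpa using hw⟩
        rw [blockFunctional_inr, Finset.sum_congr rfl fun v hv ↦
          if_neg ((Finset.mem_filter.1 hv).2 ▸ hki)]
        rw [Finset.sum_const, nsmul_eq_mul]
        linarith

/-- On the face where one functional of a transversal vanishes, the whole transversal is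
controlled by the remaining functionals. -/
theorem sum_transversal_le [Fintype D] [DecidableEq D] [Fintype R] [DecidableEq R]
    {β : D → R} {σ : J → R → D}
    (hσ : ∀ j i, β (σ j i) = i) {j : Option J} {v : D ⊕ R} (hv : v ∈ transversal σ j)
    {e : (D → ℝ) × ℝ} (hnn : ∀ u, 0 ≤ blockFunctional β u e) (hv0 : blockFunctional β v e = 0) :
    ∑ u ∈ transversal σ j, blockFunctional β u e ≤
      (2 * Fintype.card R : ℝ) * ∑ u ∈ (transversal σ j)ᶜ, blockFunctional β u e := by
  set A := ∑ u ∈ (transversal σ j)ᶜ, blockFunctional β u e with hA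
  have hx : ∀ u, 0 ≤ e.1 u := fun u ↦ hnn (Sum.inl u)
  have hA0 : 0 ≤ A := Finset.sum_nonneg fun u _ ↦ hnn u
  have hsub : ∀ s : Finset D, (∀ u ∈ s, Sum.inl u ∉ transversal σ j) → ∑ u ∈ s, e.1 u ≤ A := by
    intro s hs
    rw [show ∑ u ∈ s, e.1 u = ∑ u ∈ s.map Function.Embedding.inl, blockFunctional β u e by simp]
    refine Finset.sum_le_sum_of_subset_of_nonneg ?_ fun u _ _ ↦ hnn u
    intro u hu
    obtain ⟨w, hw, rfl⟩ := Finset.mem_map.1 hu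
    exact Finset.mem_compl.2 (hs w hw)
  have hle : ∀ u ∈ transversal σ j, blockFunctional β u e ≤ 2 * A := by
    cases j with
    | none =>
      obtain ⟨i, rfl⟩ := mem_transversal_none.1 hv
      intro u hu
      obtain ⟨k, rfl⟩ := mem_transversal_none.1 hu
      rw [blockFunctional_inr] at hv0 ⊢
      have h1 := hsub (Finset.univ.filter fun v ↦ β v = k) (by simp [mem_transversal_none])
      have h2 : 0 ≤ ∑ v with β v = i, e.1 v := Finset.sum_nonneg fun u _ ↦ hx u
      linarith
    | some j =>
      obtain ⟨i, rfl⟩ := mem_transversal_some.1 hv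
      rw [blockFunctional_inl] at hv0
      have ht : e.2 ≤ A := by
        have h1 := hsub ((Finset.univ.filter fun v ↦ β v = i).erase (σ j i)) (by
          intro u hu hmem
          obtain ⟨k, hk⟩ := mem_transversal_some.1 hmem
          obtain ⟨hne, hmem⟩ := Finset.mem_erase.1 hu
          have hk : σ j k = u := Sum.inl_injective hk
          have hki : k = i := by
            rw [← hσ j k, hk]
            exact (Finset.mem_filter.1 hmem).2
          exact hne (by rw [← hk, hki]))
        rw [Finset.sum_erase _ hv0] at h1
        have h2 := hnn (Sum.inr i)
        rw [blockFunctional_inr] at h2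
        linarith
      intro u hu
      obtain ⟨k, rfl⟩ := mem_transversal_some.1 hu
      rw [blockFunctional_inl]
      have h1 : e.1 (σ j k) ≤ ∑ v with β v = k, e.1 v :=
        Finset.single_le_sum (fun u _ ↦ hx u) (by simp [hσ])
      have h2 : blockFunctional β (Sum.inr k) e ≤ A :=
        Finset.single_le_sum (fun u _ ↦ hnn u)
          (Finset.mem_compl.2 (by simp [mem_transversal_some]))
      rw [blockFunctional_inr] at h2
      linarith
  calc ∑ u ∈ transversal σ j, blockFunctional β u e
      ≤ (transversal σ j).card • (2 * A) := Finset.sum_le_card_nsmul _ _ _ hle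
    _ = (transversal σ j).card * (2 * A) := nsmul_eq_mul _ _
    _ ≤ Fintype.card R * (2 * A) :=
      mul_le_mul_of_nonneg_right (by exact_mod_cast card_transversal_le σ j) (by linarith)
    _ = 2 * Fintype.card R * A := by ring

/-- A partition `β` of `d` coordinates into at least three blocks of size at least two, with a family
`σ` of distinct sections that together cover all coordinates, yields a nonsimplicial illuminated
`d`-polytope. -/
theorem exists_nonsimplicial_of_partition [Fintype D] [DecidableEq D] [Fintype R] [DecidableEq R]
    [Finite J] [Nonempty J] {d : ℕ} (hD : Fintype.card D = d) (β : D → R) (σ : J → R → D)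
    (hR : 3 ≤ Fintype.card R) (hβ : ∀ v, ∃ u, u ≠ v ∧ β u = β v)
    (hσ : ∀ j i, β (σ j i) = i) (hcov : ∀ v, ∃ j, σ j (β v) = v)
    (hne : ∀ j k, j ≠ k → ∃ i, σ j i ≠ σ k i) :
    ∃ P : Set (EuclideanSpace ℝ (Fin d)), IsIlluminated d P ∧
      (verts P).ncard = d + Fintype.card R + (Nat.card J + 1) ∧
      ¬ IsSimplicial P := by
  obtain ⟨j₀⟩ := ‹Nonempty J›
  have hsurj : Function.Surjective β := fun i ↦ ⟨σ j₀ i, hσ j₀ i⟩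
  have hRnt : Nontrivial R := Fintype.one_lt_card_iff_nontrivial.1 (by omega)
  have hother : ∀ i : R, ∃ k, k ≠ i := fun i ↦ exists_ne i
  let i₀ : R := Classical.arbitrary R
  let v₀ : D := σ j₀ i₀
  have he₀ : ∀ i, blockFunctional β (Sum.inr i) (Pi.single v₀ 1, 0) =
      if i = i₀ then 1 else 0 := fun i ↦ by
    simp [Pi.single_apply, v₀, hσ, eq_comm]
  have key := exists_nonsimplicial_of_stacking (d := d)
    (by simp [hD]) (blockFunctional β) (transversal σ)
    (2 * Fintype.card R : ℝ) ?_ (exists_blockFunctional_vertex hβ hsurj)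
    (exists_blockFunctional_eq_indicator hσ)
    (fun j v hv e hnn h0 ↦ sum_transversal_le hσ hv hnn h0) ?_ ?_ ?_ ?_
    (e₀ := (Pi.single v₀ 1, 0)) ?_ ?_ ?_ ?_ ?_
  · simpa [hD] using key
  · intro e he
    have hx : e.1 = 0 := funext fun v ↦ he (Sum.inl v)
    have ht := he (Sum.inr i₀)
    rw [blockFunctional_inr, hx] at ht
    exact Prod.ext hx (by simpa using ht)
  · rintro (_ | j)
    · exact ⟨_, mem_transversal_none.2 ⟨i₀, rfl⟩⟩
    · exact ⟨_, mem_transversal_some.2 ⟨i₀, rfl⟩⟩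
  · rintro (v | i)
    · obtain ⟨j, hj⟩ := hcov v
      exact ⟨some j, mem_transversal_some.2 ⟨_, congrArg Sum.inl hj⟩⟩
    · exact ⟨none, mem_transversal_none.2 ⟨i, rfl⟩⟩
  · rintro (_ | j) (_ | k) hjk
    · exact absurd rfl hjk
    · exact ⟨_, mem_transversal_none.2 ⟨i₀, rfl⟩, by simp [mem_transversal_some]⟩
    · exact ⟨_, mem_transversal_some.2 ⟨i₀, rfl⟩, by simp [mem_transversal_none]⟩
    · obtain ⟨i, hi⟩ := hne j k fun h ↦ hjk (h ▸ rfl)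
      refine ⟨_, mem_transversal_some.2 ⟨i, rfl⟩, fun hmem ↦ ?_⟩
      obtain ⟨l, hl⟩ := mem_transversal_some.1 hmem
      have hl : σ k l = σ j i := Sum.inl_injective hl
      have hli : l = i := by rw [← hσ k l, hl, hσ]
      exact hi (by rw [← hl, hli])
  · rintro (_ | j) v
    · obtain ⟨u, hu, -⟩ := hβ v₀
      by_cases h : Sum.inl u = v
      · exact ⟨Sum.inl v₀, by simp [mem_transversal_none],
          fun h' ↦ hu (Sum.inl_injective (h.trans h'.symm))⟩
      · exact ⟨Sum.inl u, by simp [mem_transversal_none], h⟩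
    · obtain ⟨k, hk⟩ := hother i₀
      by_cases h : Sum.inr k = v
      · exact ⟨Sum.inr i₀, by simp [mem_transversal_some],
          fun h' ↦ hk (Sum.inr_injective (h.trans h'.symm))⟩
      · exact ⟨Sum.inr k, by simp [mem_transversal_some], h⟩
  · intro h
    have := congrFun (congrArg Prod.fst h) v₀
    simp at this
  · rintro (v | i)
    · rw [blockFunctional_inl]
      dsimp only
      rw [Pi.single_apply]
      split_ifs <;> norm_num
    · rw [he₀]
      split_ifs <;> norm_num
  · rintro (_ | j)
    · exact ⟨Sum.inl v₀, by simp [mem_transversal_none], by simp⟩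
    · exact ⟨Sum.inr i₀, by simp [mem_transversal_some], by rw [he₀, if_pos rfl]; exact one_pos⟩
  · -- only the two functionals at `v₀` and at its block are nonzero
    have hsub : ({Sum.inl v₀, Sum.inr i₀}ᶜ : Set (D ⊕ R)) ⊆
        {v | blockFunctional β v (Pi.single v₀ 1, 0) = 0} := by
      rintro (v | i) hv
      · have : v ≠ v₀ := fun h ↦ hv (by simp [h])
        simp [this]
      · have : i ≠ i₀ := fun h ↦ hv (by simp [h])
        rw [mem_ofPred_eq, he₀, if_neg this]
    refine lt_of_lt_of_le ?_ (ncard_le_ncard hsub (toFinite _))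
    rw [ncard_compl, ncard_pair Sum.inl_ne_inr, Nat.card_eq_fintype_card, Fintype.card_sum]
    omega
  · intro e he
    obtain ⟨k, hk⟩ := hother i₀
    have hx : ∀ v, v ≠ v₀ → e.1 v = 0 := fun v hv ↦ he (Sum.inl v) (by simp [hv])
    have ht := he (Sum.inr k) (by rw [he₀, if_neg hk])
    rw [blockFunctional_inr, Finset.sum_eq_zero fun v hv ↦ hx v fun h ↦ hk (by
      rw [← (Finset.mem_filter.1 hv).2, h, hσ])] at ht
    refine ⟨e.1 v₀, Prod.ext (funext fun v ↦ ?_) (by simpa using ht)⟩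
    by_cases hv : v = v₀
    · simp [hv]
    · simp [hv, hx v hv]

end Blocks

/-! ### The numbers of blocks and vertices -/

section Numerology

theorem exists_nonsimplicial_of_grid {d r q : ℕ} (hr : 3 ≤ r) (hd : 2 * r ≤ d)
    (hq : d ≤ r * q) (hq' : r * (q - 1) < d) :
    ∃ P : Set (EuclideanSpace ℝ (Fin d)), IsIlluminated d P ∧
      (verts P).ncard = d + r + q + 1 ∧ ¬ IsSimplicial P := by
  have hr0 : 0 < r := by omega
  have hq0 : 0 < q := Nat.pos_of_ne_zero fun h ↦ by subst h; omega
  have : Nonempty (Fin q) := ⟨⟨0, hq0⟩⟩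
  -- blocks are residue classes modulo `r`; a section leaving the grid falls back to `i < r`
  let β : Fin d → Fin r := fun v ↦ ⟨v % r, Nat.mod_lt _ hr0⟩
  let σ : Fin q → Fin r → Fin d := fun j i ↦
    if h : (i : ℕ) + r * j < d then ⟨i + r * j, h⟩ else ⟨i, by omega⟩
  have key := exists_nonsimplicial_of_partition (Fintype.card_fin d) β σ (by simpa using hr) ?_ ?_ ?_ ?_
  · simpa [add_assoc] using key
  · intro v
    by_cases hv : (v : ℕ) < r
    · refine ⟨⟨v + r, by omega⟩, fun h ↦ ?_, by simp [β]⟩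
      have := congrArg Fin.val h
      simp at this
      omega
    · refine ⟨⟨v - r, by omega⟩, fun h ↦ ?_, Fin.ext (Nat.mod_eq_sub_mod (by omega)).symm⟩
      have := congrArg Fin.val h
      simp at this
      omega
  · intro j i
    apply Fin.ext
    dsimp only [σ, β]
    split_ifs <;> simp [Nat.mod_eq_of_lt i.2]
  · intro v
    refine ⟨⟨v / r, Nat.div_lt_of_lt_mul (by omega)⟩, ?_⟩
    have h : (v : ℕ) % r + r * (v / r) = v := Nat.mod_add_div _ _
    simp only [σ, β]
    rw [dif_pos (by omega)]
    exact Fin.ext h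
  · intro j k hjk
    refine ⟨⟨0, hr0⟩, fun h ↦ hjk ?_⟩
    -- the block of residue `0` has full length `q`
    have hlt : ∀ l : Fin q, 0 + r * (l : ℕ) < d := fun l ↦ by
      have : r * (l : ℕ) ≤ r * (q - 1) := Nat.mul_le_mul_left r (by omega)
      omega
    simp only [σ] at h
    rw [dif_pos (hlt j), dif_pos (hlt k), Fin.mk.injEq] at h
    exact Fin.ext (Nat.eq_of_mul_eq_mul_left hr0 (by omega))

theorem p_le_iff (d m : ℕ) : p d ≤ m ↔ d ≤ m * (m + 1) := by
  rw [p, Nat.ceil_le, div_le_iff₀ two_pos, sub_le_iff_le_add,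
    Real.sqrt_le_left (by positivity)]
  constructor
  · intro h
    have : (d : ℝ) ≤ m * (m + 1) := by nlinarith
    exact_mod_cast this
  · intro h
    have : (d : ℝ) ≤ m * (m + 1) := by exact_mod_cast h
    nlinarith

theorem M_eq {d r q : ℕ} (hr : p d = r) (hr0 : 0 < r) (hq : d ≤ r * q) (hq' : r * (q - 1) < d)
    (h : r + q + 1 ≤ d) : M d = d + r + q + 1 := by
  have hr' : (0 : ℝ) < r := by exact_mod_cast hr0
  have hceil : ⌈(d : ℝ) / (r : ℝ)⌉₊ = q := by
    have hq0 : q ≠ 0 := fun h0 ↦ by subst h0; omega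
    rw [Nat.ceil_eq_iff hq0, lt_div_iff₀ hr', div_le_iff₀ hr']
    constructor
    · rw [mul_comm]; exact_mod_cast hq'
    · rw [mul_comm]; exact_mod_cast hq
  rw [M, hr, hceil]
  omega

end Numerology

end ManiPolytope

theorem theorem3 (d : ℕ) (hd : 6 ≤ d) :
    ∃ P : Set (EuclideanSpace ℝ (Fin d)),
      ManiPolytope.IsMani d P ∧ ¬ ManiPolytope.IsSimplicial P := by
  suffices h : ∃ r q : ℕ, 3 ≤ r ∧ 2 * r ≤ d ∧ d ≤ r * q ∧ r * (q - 1) < d ∧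
      ManiPolytope.M d = d + r + q + 1 by
    obtain ⟨r, q, hr, hrd, hq, hq', hM⟩ := h
    obtain ⟨P, hP, hcard, hns⟩ := ManiPolytope.exists_nonsimplicial_of_grid hr hrd hq hq'
    exact ⟨P, ⟨hP, hcard.trans hM.symm⟩, hns⟩
  have hle : ∀ m, ManiPolytope.p d ≤ m ↔ d ≤ m * (m + 1) := ManiPolytope.p_le_iff d
  obtain rfl | hd := hd.eq_or_lt
  · -- here `p 6 = 2`, but three blocks of size two give the same number of vertices as two
    -- blocks of size three
    have hp : ManiPolytope.p 6 = 2 :=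
      le_antisymm ((hle 2).2 (by norm_num)) (not_lt.1 fun h ↦ by
        have := (hle 1).1 (by omega)
        omega)
    exact ⟨3, 2, by norm_num, by norm_num, by norm_num, by norm_num,
      ManiPolytope.M_eq (q := 3) hp (by norm_num) (by norm_num) (by norm_num) (by norm_num)⟩
  · obtain ⟨r, hr⟩ : ∃ r, ManiPolytope.p d = r := ⟨_, rfl⟩
    have hr3 : 3 ≤ r := by
      by_contra h
      have := (hle 2).1 (by omega)
      omega
    have hup : d ≤ r * (r + 1) := (hle r).1 hr.le
    have hlow : (r - 1) * r < d := by
      by_contra h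
      have := (hle (r - 1)).2 (by rw [Nat.sub_add_cancel (by omega)]; omega)
      omega
    obtain ⟨s, rfl⟩ : ∃ s, r = s + 3 := ⟨r - 3, by omega⟩
    have hlow' : (s + 2) * (s + 3) < d := hlow
    -- `q = ⌈d / r⌉`
    have hdiv := Nat.div_add_mod (d - 1) (s + 3)
    have hmod := Nat.mod_lt (d - 1) (show 0 < s + 3 by omega)
    set q := (d - 1) / (s + 3) with hq
    have hq1 : d ≤ (s + 3) * (q + 1) := by rw [mul_add]; omega
    have hq2 : (s + 3) * (q + 1 - 1) < d := by rw [Nat.add_sub_cancel]; omega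
    have hqr : q ≤ s + 3 := by
      by_contra h
      have : (s + 3) * (s + 3 + 1) ≤ (s + 3) * q := Nat.mul_le_mul_left _ (by omega)
      omega
    refine ⟨s + 3, q + 1, hr3, by nlinarith, hq1, hq2,
      ManiPolytope.M_eq hr (by omega) hq1 hq2 ?_⟩
    -- at `d = 7` the estimate `q ≤ r` is too weak; for `r = 3` use `3 * q < d` instead
    rcases Nat.eq_zero_or_pos s with rfl | hs
    · omega
    · nlinarith
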